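/- Let $\mathcal H$ be the set of functions $h:[0,1]\to\mathbb R$ of bounded variation with $h(0)=0$ (not necessarily monotone or continuous), and for $h\in\mathcal H$ let $h^*(t)=\inf\{g(t): g\in\mathcal H,\ g\ge h,\ g \text{ concave on }[0,1]\}$, $t\in[0,1]$, be its concave envelope. For an integrable random variable $Y$ let $$\rho_h(Y)=\int_0^\infty h(\mathbb P(Y>x))\,dx+\int_{-\infty}^0\bigl(h(\mathbb P(Y>x))-h(1)\bigr)\,dx ,$$ understood with values in $[-\infty,\infty]$, with $\rho_h(Y)=-\infty$ when the expression is of the form $\infty-\infty$ (so that such $Y$ do not affect a supremum). For a distribution $F$ on $\mathbb R$ with finite mean, with left-quantile function $F^{-1}(u)=\inf\{x: F(x)\ge u\}$, and an interval $C\subset[0,1]$, the $C$-concentration $F^C$ is the distribution of $$F^{-1}(U)\mathbf 1_{\{U\notin C\}}+\mathbb E[F^{-1}(U)\mid U\in C]\,\mathbf 1_{\{U\in C\}},\qquad U\sim \mathrm U[0,1]$$ (so $F^C=F$ when $C$ has length $0$). A set $\mathcal M$ of such distributions is closed under concentration if $F^C\in\mathcal M$ for all $F\in\mathcal M$ and all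 intervals $C\subset[0,1]$. Let $n\in\mathbb N$, $h\in\mathcal H$, $A\subset\mathbb R^n$, $\beta:\mathbb R^n\to\mathbb R$, and let $\widetilde{\mathcal M}$ be a set of distributions on $\mathbb R^n$ with finite first moment. Suppose that for every $\mathbf a\in A$ the set $\{F_{\mathbf a^\top\mathbf X}: F_{\mathbf X}\in\widetilde{\mathcal M}\}$ is closed under concentration. Then $$\min_{\mathbf a\in A}\Bigl(\sup_{F_{\mathbf X}\in\widetilde{\mathcal M}}\rho_h(\mathbf a^\top\mathbf X)+\beta(\mathbf a)\Bigr)=\min_{\mathbf a\in A}\Bigl(\sup_{F_{\mathbf X}\in\widetilde{\mathcal M}}\rho_{h^*}(\mathbf a^\top\mathbf X)+\beta(\mathbf a)\Bigr),$$ that is, the two problems have the same optimal value (infimum over $A$, in $[-\infty,\infty]$), and a point $\mathbf a\in A$ attains the minimum in one problem if and only if it attains the minimum in the other. -/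

import Mathlib

open MeasureTheory ProbabilityTheory Set
open scoped Matrix

noncomputable section

namespace RobustPortfolio

/-- The class `𝓗` of distortion functions: functions `h : [0,1] → ℝ` of bounded variation with
`h 0 = 0`. A function on `[0,1]` is represented by a function on `ℝ`, of which only the values on
`[0,1]` are ever used. -/
def IsDistortion (h : ℝ → ℝ) : Prop :=
  BoundedVariationOn h (Icc 0 1) ∧ h 0 = 0

/-- The concave envelope `h*` on `[0,1]`: the pointwise infimum of all concave distortion functions
that dominate `h`. -/
def concaveEnvelope (h : ℝ → ℝ) (t : ℝ) : ℝ :=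
  sInf {y : ℝ | ∃ g : ℝ → ℝ, IsDistortion g ∧ (∀ s ∈ Icc (0 : ℝ) 1, h s ≤ g s) ∧
    ConcaveOn ℝ (Icc 0 1) g ∧ y = g t}

/-- The integral `∫_S f dx` with values in `[-∞, ∞]`, the integral of the positive part minus
the integral of the negative part. If both are infinite the integral is not defined, and the value
is `⊥` (in `EReal`, `⊤ - ⊤ = ⊥`). -/
def extIntegral (S : Set ℝ) (f : ℝ → ℝ) : EReal :=
  ((∫⁻ x in S, ENNReal.ofReal (f x) : ENNReal) : EReal) -
    ((∫⁻ x in S, ENNReal.ofReal (-f x) : ENNReal) : EReal)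

/-- The distortion riskmetric
`ρ_h(Y) = ∫_0^∞ h(P(Y > x)) dx + ∫_{-∞}^0 (h(P(Y > x)) - h(1)) dx`
of a random variable `Y` on the probability space `(Ω, P)`, with values in `[-∞, ∞]`. It is the
real number of the usual definition when both integrals are finite. Where the expression has the
form `∞ - ∞`, the value is `⊥`, so that a supremum of `ρ_h` ignores such a `Y`. -/
def riskmetric (h : ℝ → ℝ) {Ω : Type*} [MeasurableSpace Ω] (P : Measure Ω) (Y : Ω → ℝ) : EReal :=
  extIntegral (Ioi 0) (fun x => h (P.real {ω | x < Y ω})) +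
    extIntegral (Iic 0) (fun x => h (P.real {ω | x < Y ω}) - h 1)

/-- The set `𝓜₁ⁿ` of all distributions on `ℝⁿ` with finite first moment. -/
def FiniteMeanLaws (n : ℕ) : Set (Measure (Fin n → ℝ)) :=
  {μ | IsProbabilityMeasure μ ∧ Integrable (fun x => ‖x‖) μ}

/-- The left-quantile function `F⁻¹(u) = inf {x | F(x) ≥ u}` of a distribution on `ℝ`
(meaningful for `0 < u < 1`; only these values matter below). -/
def leftQuantile (μ : Measure ℝ) (u : ℝ) : ℝ :=
  sInf {x : ℝ | u ≤ cdf μ x}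

/-- The `C`-concentration `F^C`: the distribution of
`F⁻¹(U) 𝟙{U ∉ C} + E[F⁻¹(U) | U ∈ C] 𝟙{U ∈ C}` with `U` uniform on `[0,1]`. -/
def concentration (μ : Measure ℝ) (C : Set ℝ) : Measure ℝ :=
  open Classical in
  (volume.restrict (Icc (0 : ℝ) 1)).map
    (fun u => if u ∈ C then ⨍ v in C, leftQuantile μ v else leftQuantile μ u)

/-- A set of distributions on `ℝ` is closed under concentration if it contains, with each `F`,
all the concentrations `F^C` for intervals `C ⊆ [0,1]` (open, closed or half-open). -/
def ClosedUnderConcentration (M : Set (Measure ℝ)) : Prop :=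
  ∀ μ ∈ M, ∀ C : Set ℝ, C.OrdConnected → C ⊆ Icc 0 1 → concentration μ C ∈ M

/-- The distributions of the portfolio loss `aᵀX`, where the distribution of `X` ranges over `M`. -/
def portfolioLaws {n : ℕ} (M : Set (Measure (Fin n → ℝ))) (a : Fin n → ℝ) : Set (Measure ℝ) :=
  (fun μ => μ.map (fun x => a ⬝ᵥ x)) '' M

/-- The objective `a ↦ sup_{F_X ∈ M} ρ_h(aᵀX) + β(a)` of the robust portfolio problem. Here `X` is
realized as the identity on the space `ℝⁿ` that carries its distribution `μ`. -/
def robustObjective {n : ℕ} (h : ℝ → ℝ) (M : Set (Measure (Fin n → ℝ)))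
    (β : (Fin n → ℝ) → ℝ) (a : Fin n → ℝ) : EReal :=
  (⨆ μ ∈ M, riskmetric h μ (fun x : Fin n → ℝ => a ⬝ᵥ x)) + (β a : EReal)

end RobustPortfolio

end

noncomputable section

namespace RobustPortfolio

/-! One inequality is immediate: `h ≤ h*` and `h 1 = h* 1` give `ρ_h ≤ ρ_{h*}`. For the converse,
interpolate `h` linearly at the vertices of its concave hull over a finite set `E k`. As the sets `E
k` increase, these polylines increase to a concave distortion function `g ≥ h`, so `h* ≤ g`, and `ρ`
of the polylines converges to `ρ_g ≥ ρ_{h*}` by monotone convergence.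

For a single polyline the supremum is handled exactly. Its riskmetric at a quantile function `q`
depends only on the integrals of `q` over the upper intervals `(1 - s j, 1)` at the vertices `s j`
(`extIntegral_polyline`). Concentrating on every cell between consecutive vertices preserves these
integrals (`exists_constant_on_cells`). Afterwards every survival probability is a vertex
(`exists_survival_eq`), where `h` and the polyline agree. Hence `ρ_h` of the concentrated law equals
the polyline's riskmetric of the original law (`exists_riskmetric_eq_polyline`), and the
concentrated law is still in the set. No continuity of `h` is required. The two objectives therefore
coincide pointwise on `A`. -/

open Filter Topology

/-! ### Concave hulls over finitely many points -/

/-- A finite set of abscissae can be thinned out, keeping `0` and `1`, so that the graph of `f` is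
in strictly concave position over what remains, without enlarging the set of dominating lines. -/
theorem exists_subset_concave_position (f : ℝ → ℝ) (E : Finset ℝ) (h0 : (0 : ℝ) ∈ E)
    (h1 : (1 : ℝ) ∈ E) (hE : ∀ e ∈ E, e ∈ Icc (0 : ℝ) 1) :
    ∃ T ⊆ E, (0 : ℝ) ∈ T ∧ (1 : ℝ) ∈ T ∧
      (∀ p ∈ T, ∀ v ∈ T, ∀ q ∈ T, p < v → v < q →
        f p * (q - v) + f q * (v - p) < f v * (q - p)) ∧
      ∀ a b : ℝ, (∀ e ∈ T, f e ≤ a * e + b) → ∀ e ∈ E, f e ≤ a * e + b := by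
  induction E using Finset.strongInduction with
  | H E ih =>
    by_cases hex : ∃ p ∈ E, ∃ v ∈ E, ∃ q ∈ E, p < v ∧ v < q ∧
        f v * (q - p) ≤ f p * (q - v) + f q * (v - p)
    -- The point over `v` lies on or below the chord from `p` to `q`, so a line dominating `f` at
    -- `p` and `q` dominates it at `v`, and `v` can be dropped.
    · obtain ⟨p, hp, v, hv, q, hq, hpv, hvq, hle⟩ := hex
      have hv0 : 0 ≠ v := ((hE p hp).1.trans_lt hpv).ne
      have hv1 : 1 ≠ v := (hvq.trans_le (hE q hq).2).ne'
      obtain ⟨T, hT, hT0, hT1, hc, hd⟩ := ih (E.erase v) (Finset.erase_ssubset hv)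
        (Finset.mem_erase.2 ⟨hv0, h0⟩) (Finset.mem_erase.2 ⟨hv1, h1⟩)
        (fun e he => hE e (Finset.mem_of_mem_erase he))
      refine ⟨T, hT.trans (Finset.erase_subset _ _), hT0, hT1, hc, fun a b hab e he => ?_⟩
      have key := hd a b hab
      by_cases hev : e = v
      · subst hev
        have h₁ := key p (Finset.mem_erase.2 ⟨hpv.ne, hp⟩)
        have h₂ := key q (Finset.mem_erase.2 ⟨hvq.ne', hq⟩)
        have h₃ : f e * (q - p) ≤ (a * e + b) * (q - p) := by
          nlinarith [mul_le_mul_of_nonneg_right h₁ (sub_nonneg.2 hvq.le),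
            mul_le_mul_of_nonneg_right h₂ (sub_nonneg.2 hpv.le)]
        exact le_of_mul_le_mul_right h₃ (by linarith)
      · exact key e (Finset.mem_erase.2 ⟨hev, he⟩)
    · push Not at hex
      exact ⟨E, subset_rfl, h0, h1, fun p hp v hv q hq hpv hvq => hex p hp v hv q hq hpv hvq,
        fun a b hab => hab⟩

/-- A partition `0 = s 0 < ⋯ < s m = 1` with points in `E`, the vertices of the least concave
majorant of the restriction of `f` to `E`: the lines through consecutive vertices dominate `f`
on `E`. -/
structure HullPartition (f : ℝ → ℝ) (E : Finset ℝ) where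
  m : ℕ
  s : ℕ → ℝ
  mono : Monotone s
  s_zero : s 0 = 0
  s_last : s m = 1
  lt_succ : ∀ i < m, s i < s (i + 1)
  mem : ∀ i ≤ m, s i ∈ E
  dominates : ∀ i < m, ∀ e ∈ E, f e ≤ f (s i) + slope f (s i) (s (i + 1)) * (e - s i)

theorem nonempty_hullPartition (f : ℝ → ℝ) (E : Finset ℝ) (h0 : (0 : ℝ) ∈ E)
    (h1 : (1 : ℝ) ∈ E) (hE : ∀ e ∈ E, e ∈ Icc (0 : ℝ) 1) : Nonempty (HullPartition f E) := by
  obtain ⟨T, hTE, hT0, hT1, hc, hd⟩ := exists_subset_concave_position f E h0 h1 hE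
  have hTI : ∀ e ∈ T, e ∈ Icc (0 : ℝ) 1 := fun e he => hE e (hTE he)
  obtain ⟨m, hm⟩ : ∃ m, T.card = m + 1 :=
    Nat.exists_eq_succ_of_ne_zero (Finset.card_ne_zero_of_mem hT0)
  let φ := T.orderEmbOfFin hm
  have hφ : ∀ i, φ i ∈ T := fun i => Finset.orderEmbOfFin_mem T hm i
  have hsurj : ∀ e ∈ T, ∃ i, φ i = e := fun e he => by
    have : e ∈ Set.range φ := by rw [Finset.range_orderEmbOfFin]; exact he
    exact this
  -- The clamp `min i m` makes `s` constant from `m` on, so it is monotone on all of `ℕ`.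
  let s : ℕ → ℝ := fun i => φ ⟨min i m, by omega⟩
  have hsT : ∀ i, s i ∈ T := fun i => hφ _
  have hmono : Monotone s := fun i j hij => φ.monotone (by simp; omega)
  have hlt : ∀ i < m, s i < s (i + 1) := fun i hi => φ.strictMono (by simp; omega)
  have hsurj' : ∀ e ∈ T, ∃ i ≤ m, s i = e := fun e he => by
    obtain ⟨i, rfl⟩ := hsurj e he
    exact ⟨i, by omega, by simp only [s]; congr 1; ext; simp; omega⟩
  have hs0 : s 0 = 0 := by
    obtain ⟨i, -, hi⟩ := hsurj' 0 hT0
    exact le_antisymm (hi ▸ hmono (Nat.zero_le i)) (hTI _ (hsT 0)).1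
  have hsm : s m = 1 := by
    obtain ⟨i, him, hi⟩ := hsurj' 1 hT1
    exact le_antisymm (hTI _ (hsT m)).2 (hi ▸ hmono him)
  refine ⟨⟨m, s, hmono, hs0, hsm, hlt, fun i _ => hTE (hsT i), fun i hi e he => ?_⟩⟩
  have hsl := hlt i hi
  have hpos : 0 < s (i + 1) - s i := sub_pos.2 hsl
  -- Strict concavity over `T` puts all its points below the line through two neighbours; `hd` then
  -- extends the bound from `T` to `E`.
  have key : ∀ e ∈ T, f e ≤ slope f (s i) (s (i + 1)) * e +
      (f (s i) - slope f (s i) (s (i + 1)) * s i) := by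
    intro e he
    obtain ⟨j, -, rfl⟩ := hsurj' e he
    rw [slope_def_field]
    set d := s (i + 1) - s i with hd
    have hgoal : f (s j) * d ≤ (f (s (i + 1)) - f (s i)) * (s j - s i) + f (s i) * d := by
      rcases lt_trichotomy j i with hji | rfl | hij
      · rcases (hmono hji.le).eq_or_lt with heq | hlt'
        · rw [heq]; simp
        · have := hc _ (hsT j) _ (hsT i) _ (hsT (i + 1)) hlt' hsl
          rw [hd]; nlinarith
      · simp
      · rcases (hmono (Nat.succ_le_of_lt hij)).eq_or_lt with heq | hlt'
        · rw [Nat.succ_eq_add_one] at heq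
          rw [← heq, hd]; nlinarith
        · have := hc _ (hsT i) _ (hsT (i + 1)) _ (hsT j) hsl hlt'
          rw [hd]; nlinarith
    have : f (s j) ≤ ((f (s (i + 1)) - f (s i)) * (s j - s i) + f (s i) * d) / d :=
      (le_div_iff₀ hpos).2 hgoal
    refine this.trans (le_of_eq ?_)
    field_simp
    ring
  have := hd _ _ key e he
  linarith

namespace HullPartition

variable {f : ℝ → ℝ} {E : Finset ℝ} (P : HullPartition f E)

/-- The slope of `f` over the `i`-th cell. -/
def c (i : ℕ) : ℝ := slope f (P.s i) (P.s (i + 1))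

/-- The piecewise linear interpolation of `f` at the points of the partition (if `f 0 = 0`). -/
def polyline (t : ℝ) : ℝ :=
  ∑ i ∈ Finset.range P.m, P.c i * (min t (P.s (i + 1)) - min t (P.s i))

theorem c_mul (i : ℕ) (hi : i < P.m) :
    P.c i * (P.s (i + 1) - P.s i) = f (P.s (i + 1)) - f (P.s i) := by
  rw [c, slope_def_field]
  have := sub_pos.2 (P.lt_succ i hi)
  field_simp

theorem s_mem (i : ℕ) (hi : i ≤ P.m) : P.s i ∈ Icc (0 : ℝ) 1 :=
  ⟨P.s_zero ▸ P.mono (Nat.zero_le i), P.s_last ▸ P.mono hi⟩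

theorem m_pos : 0 < P.m := by
  rcases Nat.eq_zero_or_pos P.m with h | h
  · have h₁ := P.s_last
    rw [h, P.s_zero] at h₁
    exact absurd h₁ zero_ne_one
  · exact h

theorem exists_cell {t : ℝ} (ht : t ∈ Icc (0 : ℝ) 1) :
    ∃ j < P.m, t ∈ Icc (P.s j) (P.s (j + 1)) := by
  have key : ∀ k, 0 < k → t ≤ P.s k → ∃ j < k, t ∈ Icc (P.s j) (P.s (j + 1)) := by
    intro k hk
    induction k, hk using Nat.le_induction with
    | base => exact fun h => ⟨0, one_pos, by rw [P.s_zero]; exact ht.1, h⟩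
    | succ k hk ih =>
      intro h
      rcases le_total t (P.s k) with h' | h'
      · obtain ⟨j, hj, hj'⟩ := ih h'
        exact ⟨j, hj.trans (Nat.lt_succ_self k), hj'⟩
      · exact ⟨k, Nat.lt_succ_self k, h', h⟩
  exact key P.m P.m_pos (P.s_last ▸ ht.2)

/-- The sum telescopes over the cells left of `t`, and the cells right of `t` contribute zero
because both minima equal `t`. -/
theorem polyline_eq (hf : f 0 = 0) {j : ℕ} (hj : j < P.m) {t : ℝ}
    (ht : t ∈ Icc (P.s j) (P.s (j + 1))) :
    P.polyline t = f (P.s j) + P.c j * (t - P.s j) := by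
  have h₁ : ∀ k ≤ j, ∑ i ∈ Finset.range k, P.c i * (min t (P.s (i + 1)) - min t (P.s i)) =
      f (P.s k) := by
    intro k
    induction k with
    | zero => intro _; simp [P.s_zero, hf]
    | succ k ih =>
      intro hk
      rw [Finset.sum_range_succ, ih (by omega), min_eq_right ((P.mono hk).trans ht.1),
        min_eq_right ((P.mono (by omega : k ≤ j)).trans ht.1), P.c_mul k (by omega)]
      ring
  have h₂ : ∀ k, j + 1 ≤ k →
      ∑ i ∈ Finset.range k, P.c i * (min t (P.s (i + 1)) - min t (P.s i)) =
      f (P.s j) + P.c j * (t - P.s j) := by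
    intro k hk
    induction k, hk using Nat.le_induction with
    | base =>
      rw [Finset.sum_range_succ, h₁ j le_rfl, min_eq_left ht.2, min_eq_right ht.1]
    | succ k hk ih =>
      rw [Finset.sum_range_succ, ih, min_eq_left (ht.2.trans (P.mono hk)),
        min_eq_left (ht.2.trans (P.mono (hk.trans (Nat.le_succ k))))]
      ring
  exact h₂ P.m hj

theorem polyline_s (hf : f 0 = 0) {j : ℕ} (hj : j ≤ P.m) : P.polyline (P.s j) = f (P.s j) := by
  rcases hj.eq_or_lt with rfl | hj
  -- No cell starts at the last vertex, so it is treated as the right end of the last cell.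
  · obtain ⟨k, hk⟩ := Nat.exists_eq_succ_of_ne_zero P.m_pos.ne'
    have hk' : k < P.m := by omega
    rw [hk, Nat.succ_eq_add_one, P.polyline_eq hf hk' ⟨P.mono (Nat.le_succ k), le_rfl⟩,
      P.c_mul k hk']
    ring
  · rw [P.polyline_eq hf hj ⟨le_rfl, P.mono (Nat.le_succ j)⟩]
    ring

theorem polyline_zero (hf : f 0 = 0) : P.polyline 0 = 0 := by
  have := P.polyline_s hf (Nat.zero_le _)
  rwa [P.s_zero, hf] at this

theorem polyline_one (hf : f 0 = 0) : P.polyline 1 = f 1 := by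
  have := P.polyline_s hf le_rfl
  rwa [P.s_last] at this

/-- A line that dominates `f` at the points of the partition dominates the interpolation. -/
theorem polyline_le_line (hf : f 0 = 0) {a b : ℝ} (hab : ∀ i ≤ P.m, f (P.s i) ≤ a * P.s i + b)
    {t : ℝ} (ht : t ∈ Icc (0 : ℝ) 1) : P.polyline t ≤ a * t + b := by
  obtain ⟨j, hj, hjt⟩ := P.exists_cell ht
  rw [P.polyline_eq hf hj hjt]
  have h₁ := hab j hj.le
  have h₂ := hab (j + 1) hj
  have h₃ := P.c_mul j hj
  have hpos := sub_pos.2 (P.lt_succ j hj)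
  have : (f (P.s j) + P.c j * (t - P.s j)) * (P.s (j + 1) - P.s j) ≤
      (a * t + b) * (P.s (j + 1) - P.s j) := by
    have e₁ : (f (P.s j) + P.c j * (t - P.s j)) * (P.s (j + 1) - P.s j) =
        f (P.s j) * (P.s (j + 1) - t) + f (P.s (j + 1)) * (t - P.s j) := by
      linear_combination (t - P.s j) * h₃
    rw [e₁]
    nlinarith [mul_le_mul_of_nonneg_right h₁ (sub_nonneg.2 hjt.2),
      mul_le_mul_of_nonneg_right h₂ (sub_nonneg.2 hjt.1)]
  exact le_of_mul_le_mul_right this hpos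

/-- A cell line of `Q` dominates `f` on `E'`, hence at the vertices of `P`, hence it dominates
`P.polyline`; on its own cell it is `Q.polyline`. -/
theorem polyline_mono (hf : f 0 = 0) {E' : Finset ℝ} (Q : HullPartition f E') (hE : E ⊆ E')
    {t : ℝ} (ht : t ∈ Icc (0 : ℝ) 1) : P.polyline t ≤ Q.polyline t := by
  obtain ⟨j, hj, hjt⟩ := Q.exists_cell ht
  rw [Q.polyline_eq hf hj hjt]
  have := P.polyline_le_line hf (a := Q.c j) (b := f (Q.s j) - Q.c j * Q.s j) (fun i hi => by
    have := Q.dominates j hj _ (hE (P.mem i hi))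
    rw [← c] at this
    linarith) ht
  linarith

theorem polyline_le_cell (hf : f 0 = 0) {j : ℕ} (hj : j < P.m) {t : ℝ}
    (ht : t ∈ Icc (0 : ℝ) 1) : P.polyline t ≤ f (P.s j) + P.c j * (t - P.s j) := by
  have := P.polyline_le_line hf (a := P.c j) (b := f (P.s j) - P.c j * P.s j) (fun i hi => by
    have := P.dominates j hj _ (P.mem i hi)
    rw [← c] at this
    linarith) ht
  linarith

theorem le_polyline (hf : f 0 = 0) {e : ℝ} (he : e ∈ E) (he' : e ∈ Icc (0 : ℝ) 1) :
    f e ≤ P.polyline e := by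
  obtain ⟨j, hj, hjt⟩ := P.exists_cell he'
  rw [P.polyline_eq hf hj hjt]
  exact P.dominates j hj e he

/-- By `polyline_le_cell` the polyline is the minimum of its cell lines. -/
theorem concaveOn_polyline (hf : f 0 = 0) : ConcaveOn ℝ (Icc 0 1) P.polyline := by
  refine ⟨convex_Icc 0 1, fun x hx y hy a b ha hb hab => ?_⟩
  have hz := convex_Icc (0 : ℝ) 1 hx hy ha hb hab
  obtain ⟨j, hj, hjt⟩ := P.exists_cell hz
  rw [P.polyline_eq hf hj hjt]
  simp only [smul_eq_mul]
  have hx' := mul_le_mul_of_nonneg_left (P.polyline_le_cell hf hj hx) ha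
  have hy' := mul_le_mul_of_nonneg_left (P.polyline_le_cell hf hj hy) hb
  have : f (P.s j) = a * f (P.s j) + b * f (P.s j) := by rw [← add_mul, hab, one_mul]
  have h₂ : P.s j = a * P.s j + b * P.s j := by rw [← add_mul, hab, one_mul]
  calc a * P.polyline x + b * P.polyline y
      ≤ a * (f (P.s j) + P.c j * (x - P.s j)) + b * (f (P.s j) + P.c j * (y - P.s j)) :=
        add_le_add hx' hy'
    _ = f (P.s j) + P.c j * (a * x + b * y - P.s j) := by
        linear_combination (f (P.s j) - P.c j * P.s j) * hab

theorem continuous_polyline : Continuous P.polyline := by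
  unfold polyline
  fun_prop

end HullPartition

/-! ### Increasing approximation of a concave majorant -/

theorem eVariationOn_neg (f : ℝ → ℝ) (s : Set ℝ) :
    eVariationOn (fun x => -f x) s = eVariationOn f s := by
  simp only [eVariationOn, edist_neg_neg]

/-- A continuous concave function increases up to a maximizer and decreases afterwards, which
bounds its variation. -/
theorem eVariationOn_le_of_concaveOn {f : ℝ → ℝ} (hf : ConcaveOn ℝ (Icc 0 1) f)
    (hc : ContinuousOn f (Icc 0 1)) {B : ℝ} (hB : ∀ t ∈ Icc (0 : ℝ) 1, f t ≤ B) :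
    eVariationOn f (Icc 0 1) ≤ ENNReal.ofReal (B - f 0) + ENNReal.ofReal (B - f 1) := by
  obtain ⟨c, hcI, hmax⟩ := isCompact_Icc.exists_isMaxOn (nonempty_Icc.2 zero_le_one) hc
  have hm : MonotoneOn f (Icc 0 c) := fun x hx y hy hxy => by
    have := hf.min_le_of_mem_Icc (x := x) (y := c) (z := y) ⟨hx.1, hx.2.trans hcI.2⟩ hcI
      ⟨hxy, hy.2⟩
    rwa [min_eq_left (hmax ⟨hx.1, hx.2.trans hcI.2⟩)] at this
  have ha : MonotoneOn (fun x => -f x) (Icc c 1) := fun x hx y hy hxy => by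
    have := hf.min_le_of_mem_Icc (x := c) (y := y) (z := x) hcI ⟨hcI.1.trans hy.1, hy.2⟩
      ⟨hx.1, hxy⟩
    rw [min_eq_right (hmax ⟨hcI.1.trans hy.1, hy.2⟩)] at this
    exact neg_le_neg this
  have e₁ := hm.eVariationOn_eq (a := 0) (b := c) ⟨le_rfl, hcI.1⟩ ⟨hcI.1, le_rfl⟩
  have e₂ := ha.eVariationOn_eq (a := c) (b := 1) ⟨le_rfl, hcI.2⟩ ⟨hcI.2, le_rfl⟩
  rw [inter_self] at e₁ e₂
  have key := eVariationOn.Icc_add_Icc f (s := Icc 0 1) hcI.1 hcI.2 hcI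
  rw [inter_self, inter_eq_right.2 (Icc_subset_Icc_right hcI.2),
    inter_eq_right.2 (Icc_subset_Icc_left hcI.1), e₁, ← eVariationOn_neg f (Icc c 1), e₂] at key
  rw [← key]
  have := hB c hcI
  exact add_le_add (ENNReal.ofReal_le_ofReal (by linarith)) (ENNReal.ofReal_le_ofReal (by linarith))

/-- A countable subset of `[0,1]` over which the graph of `f` is dense in its graph. -/
theorem exists_countable_graph_dense (f : ℝ → ℝ) :
    ∃ D ⊆ Icc (0 : ℝ) 1, D.Countable ∧ (0 : ℝ) ∈ D ∧ (1 : ℝ) ∈ D ∧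
      ∀ t ∈ Icc (0 : ℝ) 1, (t, f t) ∈ closure ((fun d => (d, f d)) '' D) := by
  obtain ⟨G, hG, hGc, hd⟩ := (TopologicalSpace.IsSeparable.of_separableSpace
    ((fun t => (t, f t)) '' Icc (0 : ℝ) 1)).exists_countable_dense_subset
  have hGD : (fun d => (d, f d)) '' (Prod.fst '' G) = G := by
    ext p
    constructor
    · rintro ⟨-, ⟨p, hp, rfl⟩, rfl⟩
      obtain ⟨t, -, rfl⟩ := hG hp
      exact hp
    · intro hp
      obtain ⟨t, -, rfl⟩ := hG hp
      exact ⟨t, ⟨_, hp, rfl⟩, rfl⟩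
  refine ⟨insert 0 (insert 1 (Prod.fst '' G)), ?_, ((hGc.image _).insert 1).insert 0, by simp,
    by simp, fun t ht => ?_⟩
  · rintro d (rfl | rfl | ⟨p, hp, rfl⟩)
    · simp
    · simp
    · obtain ⟨t, ht, rfl⟩ := hG hp
      exact ht
  · refine closure_mono ?_ (hd ⟨t, ht, rfl⟩)
    conv_lhs => rw [← hGD]
    exact image_mono fun d hd => Or.inr (Or.inr hd)

/-- Interpolations of a distortion function `h` at finitely many points increase to a concave
distortion function that dominates `h` and agrees with it at `1`. -/
theorem exists_hull_sequence {h : ℝ → ℝ} (hh : IsDistortion h) :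
    ∃ (E : ℕ → Finset ℝ) (P : ∀ k, HullPartition h (E k)) (g : ℝ → ℝ),
      (∀ t ∈ Icc (0 : ℝ) 1, Monotone fun k => (P k).polyline t) ∧
      (∀ t ∈ Icc (0 : ℝ) 1, Tendsto (fun k => (P k).polyline t) atTop (𝓝 (g t))) ∧
      IsDistortion g ∧ ConcaveOn ℝ (Icc 0 1) g ∧ (∀ t ∈ Icc (0 : ℝ) 1, h t ≤ g t) ∧
      g 1 = h 1 := by
  have I0 : (0 : ℝ) ∈ Icc (0 : ℝ) 1 := by simp
  have I1 : (1 : ℝ) ∈ Icc (0 : ℝ) 1 := by simp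
  obtain ⟨D, hDI, hDc, hD0, hD1, hDd⟩ := exists_countable_graph_dense h
  obtain ⟨d, rfl⟩ := hDc.exists_eq_range ⟨0, hD0⟩
  have hdI : ∀ i, d i ∈ Icc (0 : ℝ) 1 := fun i => hDI ⟨i, rfl⟩
  let E : ℕ → Finset ℝ := fun k => insert 0 (insert 1 ((Finset.range k).image d))
  have hE : ∀ k, ∀ e ∈ E k, e ∈ Icc (0 : ℝ) 1 := by
    intro k e he
    simp only [E, Finset.mem_insert, Finset.mem_image] at he
    rcases he with rfl | rfl | ⟨i, -, rfl⟩
    exacts [I0, I1, hdI i]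
  have hEmono : Monotone E := fun i j hij =>
    Finset.insert_subset_insert _ (Finset.insert_subset_insert _
      (Finset.image_subset_image (Finset.range_subset_range.2 hij)))
  have P : ∀ k, HullPartition h (E k) := fun k =>
    (nonempty_hullPartition h (E k) (by simp [E]) (by simp [E]) (hE k)).some
  let B : ℝ := (eVariationOn h (Icc 0 1)).toReal
  have hhB : ∀ t ∈ Icc (0 : ℝ) 1, h t ≤ B := fun t ht => by
    have := hh.1.sub_le ht I0
    rwa [hh.2, sub_zero] at this
  have hPB : ∀ k, ∀ t ∈ Icc (0 : ℝ) 1, (P k).polyline t ≤ B := fun k t ht => by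
    have := (P k).polyline_le_line hh.2 (a := 0) (b := B) (fun i hi => by
      rw [zero_mul, zero_add]
      exact hhB _ ((P k).s_mem i hi)) ht
    rwa [zero_mul, zero_add] at this
  have hmono : ∀ t ∈ Icc (0 : ℝ) 1, Monotone fun k => (P k).polyline t := fun t ht i j hij =>
    (P i).polyline_mono hh.2 (P j) (hEmono hij) ht
  let g : ℝ → ℝ := fun t => ⨆ k, (P k).polyline t
  have hg : ∀ t ∈ Icc (0 : ℝ) 1, Tendsto (fun k => (P k).polyline t) atTop (𝓝 (g t)) :=
    fun t ht => tendsto_atTop_ciSup (hmono t ht) ⟨B, by rintro _ ⟨k, rfl⟩; exact hPB k t ht⟩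
  have hPg : ∀ k, ∀ t ∈ Icc (0 : ℝ) 1, (P k).polyline t ≤ g t := fun k t ht =>
    (hmono t ht).ge_of_tendsto (hg t ht) k
  have hconc : ConcaveOn ℝ (Icc 0 1) g := by
    refine ⟨convex_Icc 0 1, fun x hx y hy a b ha hb hab => ?_⟩
    refine le_of_tendsto_of_tendsto (((hg x hx).const_smul a).add ((hg y hy).const_smul b))
      (hg _ (convex_Icc (0 : ℝ) 1 hx hy ha hb hab)) (Eventually.of_forall fun k => ?_)
    exact ((P k).concaveOn_polyline hh.2).2 hx hy ha hb hab
  have hg0 : g 0 = 0 := by simp only [g, (P _).polyline_zero hh.2, ciSup_const]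
  have hg1 : g 1 = h 1 := by simp only [g, (P _).polyline_one hh.2, ciSup_const]
  have hgd : ∀ i, h (d i) ≤ g (d i) := fun i =>
    ((P (i + 1)).le_polyline hh.2 (e := d i) (Finset.mem_insert_of_mem (Finset.mem_insert_of_mem
      (Finset.mem_image_of_mem _ (Finset.self_mem_range_succ i)))) (hdI i)).trans
      (hPg _ _ (hdI i))
  refine ⟨E, P, g, hmono, hg, ⟨?_, hg0⟩, hconc, fun t ht => ?_, hg1⟩
  · intro htop
    -- Variation is lower semicontinuous under pointwise limits, and every polyline has variation at
    -- most this sum, being bounded by `B` with end values `0` and `h 1`.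
    have hlt : ENNReal.ofReal B + ENNReal.ofReal (B - h 1) < eVariationOn g (Icc 0 1) := by
      rw [htop]
      exact ENNReal.add_lt_top.2 ⟨ENNReal.ofReal_lt_top, ENNReal.ofReal_lt_top⟩
    obtain ⟨k, hk⟩ := (eVariationOn.lowerSemicontinuous_aux hg hlt).exists
    refine absurd hk (not_lt.2 ?_)
    have := eVariationOn_le_of_concaveOn ((P k).concaveOn_polyline hh.2)
      (P k).continuous_polyline.continuousOn (hPB k)
    rwa [(P k).polyline_zero hh.2, (P k).polyline_one hh.2, sub_zero] at this
  -- A concave function may jump at `0` and `1`, so these are treated apart. Inside, `g` is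
  -- continuous, and density of the graph carries `h ≤ g` over from `D` even where `h` jumps.
  · rcases eq_or_ne t 0 with rfl | ht0
    · rw [hg0, hh.2]
    rcases eq_or_ne t 1 with rfl | ht1
    · exact hg1.ge
    have htI : t ∈ Ioo (0 : ℝ) 1 := ⟨lt_of_le_of_ne ht.1 ht0.symm, lt_of_le_of_ne ht.2 ht1⟩
    have hcont : ContinuousAt g t := by
      have := hconc.continuousOn_interior
      rw [interior_Icc] at this
      exact this.continuousAt (isOpen_Ioo.mem_nhds htI)
    obtain ⟨x, hx, hxt⟩ := mem_closure_iff_seq_limit.1 (hDd t ht)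
    have h₁ : Tendsto (fun n => (x n).1) atTop (𝓝 t) := (continuous_fst.tendsto _).comp hxt
    have h₂ : Tendsto (fun n => (x n).2) atTop (𝓝 (h t)) := (continuous_snd.tendsto _).comp hxt
    refine le_of_tendsto_of_tendsto h₂ (hcont.tendsto.comp h₁) (Eventually.of_forall fun n => ?_)
    obtain ⟨_, ⟨i, rfl⟩, hi⟩ := hx n
    simp only [Function.comp_apply]
    rw [← hi]
    exact hgd i

/-! ### The concave envelope -/

theorem bddBelow_concave_majorants (h : ℝ → ℝ) {t : ℝ} (ht : t ∈ Icc (0 : ℝ) 1) :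
    BddBelow {y : ℝ | ∃ g : ℝ → ℝ, IsDistortion g ∧ (∀ s ∈ Icc (0 : ℝ) 1, h s ≤ g s) ∧
      ConcaveOn ℝ (Icc 0 1) g ∧ y = g t} :=
  ⟨h t, by rintro _ ⟨g, -, hg, -, rfl⟩; exact hg t ht⟩

theorem concaveEnvelope_le {h g : ℝ → ℝ} (hg : IsDistortion g)
    (hhg : ∀ s ∈ Icc (0 : ℝ) 1, h s ≤ g s) (hc : ConcaveOn ℝ (Icc 0 1) g) {t : ℝ}
    (ht : t ∈ Icc (0 : ℝ) 1) : concaveEnvelope h t ≤ g t :=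
  csInf_le (bddBelow_concave_majorants h ht) ⟨g, hg, hhg, hc, rfl⟩

/-- The limit `g` only shows that the set of majorants is nonempty; otherwise `sInf` would be the
default value `0`. -/
theorem le_concaveEnvelope {h : ℝ → ℝ} (hh : IsDistortion h) {t : ℝ}
    (ht : t ∈ Icc (0 : ℝ) 1) : h t ≤ concaveEnvelope h t := by
  obtain ⟨-, -, g, -, -, hg, hc, hhg, -⟩ := exists_hull_sequence hh
  refine le_csInf ⟨g t, g, hg, hhg, hc, rfl⟩ ?_
  rintro _ ⟨g, -, hg, -, rfl⟩
  exact hg t ht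

/-- The second integral in `ρ_h` subtracts `h 1`, so comparing `ρ_h` with `ρ_{h*}` needs equality at
`1`. -/
theorem concaveEnvelope_one {h : ℝ → ℝ} (hh : IsDistortion h) :
    concaveEnvelope h 1 = h 1 := by
  obtain ⟨-, -, g, -, -, hg, hc, hhg, hg1⟩ := exists_hull_sequence hh
  exact le_antisymm (hg1 ▸ concaveEnvelope_le hg hhg hc (by simp))
    (le_concaveEnvelope hh (by simp))

/-! ### Extended integrals and monotone convergence -/

/-- Integrability plays no role: with `⊤ - ⊤ = ⊥`, subtraction in `EReal` is still monotone on the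
left and antitone on the right. -/
theorem extIntegral_mono {S : Set ℝ} (hS : MeasurableSet S) {f g : ℝ → ℝ}
    (hfg : ∀ x ∈ S, f x ≤ g x) : extIntegral S f ≤ extIntegral S g :=
  EReal.sub_le_sub
    (EReal.coe_ennreal_le_coe_ennreal_iff.2 (setLIntegral_mono' hS fun x hx =>
      ENNReal.ofReal_le_ofReal (hfg x hx)))
    (EReal.coe_ennreal_le_coe_ennreal_iff.2 (setLIntegral_mono' hS fun x hx =>
      ENNReal.ofReal_le_ofReal (neg_le_neg (hfg x hx))))

theorem lintegral_ofReal_ne_top {S : Set ℝ} {f : ℝ → ℝ} (hf : IntegrableOn f S) :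
    ∫⁻ x in S, ENNReal.ofReal (f x) ≠ ⊤ :=
  (Integrable.lintegral_lt_top hf).ne

theorem extIntegral_eq_integral {S : Set ℝ} {f : ℝ → ℝ} (hf : IntegrableOn f S) :
    extIntegral S f = ((∫ x in S, f x : ℝ) : EReal) := by
  rw [extIntegral, integral_eq_lintegral_pos_part_sub_lintegral_neg_part hf, EReal.coe_sub,
    EReal.coe_ennreal_toReal (lintegral_ofReal_ne_top hf),
    EReal.coe_ennreal_toReal (show ∫⁻ x in S, ENNReal.ofReal (-f x) ≠ ⊤ from
      lintegral_ofReal_ne_top hf.neg)]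

/-- Monotone convergence for the extended integral. -/
theorem tendsto_extIntegral {S : Set ℝ} (hS : MeasurableSet S) {f : ℕ → ℝ → ℝ} {F : ℝ → ℝ}
    (hm : ∀ n, Measurable (f n)) (hmono : ∀ x ∈ S, Monotone fun n => f n x)
    (hlim : ∀ x ∈ S, Tendsto (fun n => f n x) atTop (𝓝 (F x))) (h0 : IntegrableOn (f 0) S) :
    Tendsto (fun n => extIntegral S (f n)) atTop (𝓝 (extIntegral S F)) ∧
      extIntegral S F ≠ ⊥ := by
  have hpos : Tendsto (fun n => ∫⁻ x in S, ENNReal.ofReal (f n x)) atTop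
      (𝓝 (∫⁻ x in S, ENNReal.ofReal (F x))) :=
    lintegral_tendsto_of_tendsto_of_monotone (fun n => (hm n).ennreal_ofReal.aemeasurable)
      ((ae_restrict_mem hS).mono fun x hx i j hij => ENNReal.ofReal_le_ofReal (hmono x hx hij))
      ((ae_restrict_mem hS).mono fun x hx => (ENNReal.tendsto_ofReal (hlim x hx)))
  have hneg : Tendsto (fun n => ∫⁻ x in S, ENNReal.ofReal (-f n x)) atTop
      (𝓝 (∫⁻ x in S, ENNReal.ofReal (-F x))) :=
    lintegral_tendsto_of_tendsto_of_antitone (fun n => (hm n).neg.ennreal_ofReal.aemeasurable)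
      ((ae_restrict_mem hS).mono fun x hx i j hij =>
        ENNReal.ofReal_le_ofReal (neg_le_neg (hmono x hx hij)))
      (lintegral_ofReal_ne_top h0.neg)
      ((ae_restrict_mem hS).mono fun x hx => (ENNReal.tendsto_ofReal (hlim x hx).neg))
  -- The negative part of `F` is at most that of the integrable `f 0`. This rules out `⊤ + ⊥`, where
  -- addition in `EReal` is discontinuous.
  have hfin : ∫⁻ x in S, ENNReal.ofReal (-F x) ≠ ⊤ := by
    refine ne_top_of_le_ne_top (lintegral_ofReal_ne_top h0.neg) ?_
    exact setLIntegral_mono' hS fun x hx => ENNReal.ofReal_le_ofReal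
      (neg_le_neg ((hmono x hx).ge_of_tendsto (hlim x hx) 0))
  have hne : -((∫⁻ x in S, ENNReal.ofReal (-F x) : ENNReal) : EReal) ≠ ⊥ := by
    rw [Ne, EReal.neg_eq_bot_iff]
    exact fun h => hfin (EReal.coe_ennreal_eq_top_iff.1 h)
  have hne' : ((∫⁻ x in S, ENNReal.ofReal (F x) : ENNReal) : EReal) ≠ ⊥ :=
    EReal.coe_ennreal_ne_bot _
  constructor
  · simp only [extIntegral, sub_eq_add_neg]
    have h₁ := (continuous_coe_ennreal_ereal.tendsto _).comp hpos
    have h₂ := (continuous_neg.tendsto _).comp ((continuous_coe_ennreal_ereal.tendsto _).comp hneg)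
    exact (EReal.continuousAt_add (p := (_, _)) (Or.inr hne) (Or.inl hne')).tendsto.comp
      (h₁.prodMk_nhds h₂)
  · rw [extIntegral, sub_eq_add_neg, Ne, EReal.add_eq_bot_iff]
    exact fun h => h.elim hne' hne

/-! ### Layer cake formulas -/

section LayerCake

variable {α : Type*} [MeasurableSpace α] {κ : Measure α} {q : α → ℝ}

theorem measurable_measureReal_lt (κ : Measure α) [IsFiniteMeasure κ] (q : α → ℝ) :
    Measurable fun x : ℝ => κ.real {a | x < q a} :=
  Antitone.measurable fun _ _ hxy => measureReal_mono fun _ h => lt_of_le_of_lt hxy h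

theorem integrableOn_and_integral_measureReal_lt (hq : Integrable q κ) :
    IntegrableOn (fun x => κ.real {a | x < q a}) (Ioi 0) ∧
      ∫ x in Ioi 0, κ.real {a | x < q a} = ∫ a, max (q a) 0 ∂κ := by
  have hpos : Integrable (fun a => max (q a) 0) κ := hq.pos_part
  have hset : ∀ x ∈ Ioi (0 : ℝ), {a | x < q a} = {a | x < max (q a) 0} := fun x hx => by
    ext a
    simp [not_lt.2 (le_of_lt (mem_Ioi.1 hx))]
  have hnn : 0 ≤ᵐ[κ] fun a => max (q a) 0 := ae_of_all _ fun a => le_max_right _ _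
  constructor
  · have h₁ := lintegral_eq_lintegral_meas_lt κ hnn hpos.aemeasurable
    have h₂ : ∫⁻ x in Ioi 0, κ {a | x < q a} ≠ ⊤ := by
      rw [setLIntegral_congr_fun (g := fun x => κ {a | x < max (q a) 0}) measurableSet_Ioi
        (fun x hx => by simp only [hset x hx]), ← h₁]
      exact (Integrable.lintegral_lt_top hpos).ne
    refine integrable_toReal_of_lintegral_ne_top ?_ h₂
    exact (Antitone.measurable fun x y hxy =>
      measure_mono fun a (h : y < q a) => lt_of_le_of_lt hxy h).aemeasurable
  · rw [hpos.integral_eq_integral_meas_lt hnn]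
    exact setIntegral_congr_fun measurableSet_Ioi fun x hx => by simp only [hset x hx]

theorem integrableOn_and_integral_measureReal_lt_sub [IsFiniteMeasure κ] (hq : Integrable q κ) :
    IntegrableOn (fun x => κ.real {a | x < q a} - κ.real univ) (Iic 0) ∧
      ∫ x in Iic 0, (κ.real {a | x < q a} - κ.real univ) = -∫ a, max (-q a) 0 ∂κ := by
  obtain ⟨h₁, h₂⟩ := integrableOn_and_integral_measureReal_lt hq.neg
  -- Reflection turns `<` into `≤`; the two level functions agree for almost every `x`.
  have hae : (fun x : ℝ => κ.real {a | x ≤ -q a}) =ᵐ[volume.restrict (Ioi 0)]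
      fun x => κ.real {a | x < -q a} := by
    filter_upwards [meas_le_ae_eq_meas_lt κ (volume.restrict (Ioi (0 : ℝ))) (fun a => -q a)]
      with x hx using congrArg ENNReal.toReal hx
  have h₃ : IntegrableOn (fun x : ℝ => κ.real {a | x ≤ -q a}) (Ioi 0) := h₁.congr hae.symm
  have h₄ : IntegrableOn (fun x : ℝ => κ.real {a | -x ≤ -q a}) (Iic 0) := by
    rw [integrableOn_Iic_iff_integrableOn_Iio]
    exact IntegrableOn.comp_neg_Iio (c := (0 : ℝ)) (f := fun x => κ.real {a | x ≤ -q a})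
      (by rwa [neg_zero])
  have heq : ∀ x : ℝ, κ.real {a | x < q a} - κ.real univ = -κ.real {a | -x ≤ -q a} := fun x => by
    have hnull : NullMeasurableSet {a | -x ≤ -q a} κ :=
      nullMeasurableSet_le aemeasurable_const hq.neg.aemeasurable
    have hc : {a | x < q a} = {a | -x ≤ -q a}ᶜ := by ext a; simp
    rw [hc, measureReal_compl₀ hnull]
    ring
  simp only [heq]
  refine ⟨h₄.neg, ?_⟩
  rw [integral_neg, integral_comp_neg_Iic (0 : ℝ) (fun x => κ.real {a | x ≤ -q a}), neg_zero,
    integral_congr_ae hae]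
  exact congrArg _ h₂

/-- The layer cake formula for an integrable function of arbitrary sign. -/
theorem integral_measureReal_lt_add [IsFiniteMeasure κ] (hq : Integrable q κ) :
    (∫ x in Ioi 0, κ.real {a | x < q a}) + ∫ x in Iic 0, (κ.real {a | x < q a} - κ.real univ) =
      ∫ a, q a ∂κ := by
  rw [(integrableOn_and_integral_measureReal_lt hq).2,
    (integrableOn_and_integral_measureReal_lt_sub hq).2, ← sub_eq_add_neg,
    ← integral_sub hq.pos_part (show Integrable (fun a => max (-q a) 0) κ from hq.neg.pos_part)]
  refine integral_congr_ae (ae_of_all _ fun a => ?_)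
  simp only
  rcases le_total (q a) 0 with h | h <;> simp [h]

end LayerCake

/-! ### Truncated survival functions -/

/-- The uniform distribution on the unit interval. -/
abbrev uniform : Measure ℝ := volume.restrict (Ioo (0 : ℝ) 1)

/-- The upper part of the unit interval, of length `s`. -/
abbrev top (s : ℝ) : Set ℝ := Ioo (1 - s) 1

theorem restrict_Icc_eq_uniform : (volume.restrict (Icc (0 : ℝ) 1) : Measure ℝ) = uniform :=
  (Measure.restrict_congr_set Ioo_ae_eq_Icc).symm

instance : IsProbabilityMeasure uniform := ⟨by simp⟩

theorem top_subset {s : ℝ} (hs : s ∈ Icc (0 : ℝ) 1) : top s ⊆ Ioo 0 1 :=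
  Ioo_subset_Ioo_left (by linarith [hs.2])

theorem measureReal_top_univ {s : ℝ} (hs : s ∈ Icc (0 : ℝ) 1) :
    (volume.restrict (top s)).real univ = s := by
  rw [measureReal_restrict_apply_univ, Real.volume_real_Ioo_of_le (by linarith [hs.1])]
  ring

/-- For a monotone `q`, the superlevel sets are upper parts of the unit interval. -/
theorem measureReal_top_lt {q : ℝ → ℝ} (hq : MonotoneOn q (Ioo 0 1)) {s : ℝ}
    (hs : s ∈ Icc (0 : ℝ) 1) (x : ℝ) :
    (volume.restrict (top s)).real {u | x < q u} = min (uniform.real {u | x < q u}) s := by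
  have hle : (volume.restrict (top s)).real {u | x < q u} ≤ uniform.real {u | x < q u} :=
    ENNReal.toReal_mono (measure_ne_top _ _)
      (Measure.restrict_mono_set _ (top_subset hs) _)
  -- Either the superlevel set reaches below `1 - s` and so contains `top s`, or it lies in `top s`
  -- up to points outside the unit interval.
  by_cases hex : ∃ v ∈ Ioo (0 : ℝ) 1, v ≤ 1 - s ∧ x < q v
  · obtain ⟨v, hv, hvs, hxv⟩ := hex
    have hall : (volume.restrict (top s)).real {u | x < q u} = s := by
      rw [measureReal_restrict_apply' measurableSet_Ioo, inter_eq_right.2,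
        ← measureReal_restrict_apply_univ, measureReal_top_univ hs]
      exact fun u hu => hxv.trans_le (hq hv (top_subset hs hu) (hvs.trans hu.1.le))
    rw [hall] at hle ⊢
    exact (min_eq_right hle).symm
  · push Not at hex
    have hsame : (volume.restrict (top s)).real {u | x < q u} = uniform.real {u | x < q u} := by
      rw [measureReal_restrict_apply' measurableSet_Ioo,
        measureReal_restrict_apply' measurableSet_Ioo]
      congr 1
      ext u
      constructor
      · exact fun h => ⟨h.1, top_subset hs h.2⟩
      · refine fun h => ⟨h.1, ?_, h.2.2⟩
        by_contra hu
        exact absurd h.1 (not_lt.2 (hex u h.2 (not_lt.1 hu)))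
    rw [hsame, min_eq_left]
    rw [← hsame]
    calc (volume.restrict (top s)).real {u | x < q u}
        ≤ (volume.restrict (top s)).real univ := measureReal_mono (subset_univ _)
      _ = s := measureReal_top_univ hs

/-- The truncation at `s` is the survival function of `q` under the restriction to `top s`, a
measure of mass `s`, to which the layer cake formula applies. -/
theorem integrableOn_min_survival {q : ℝ → ℝ} (hq : MonotoneOn q (Ioo 0 1))
    (hi : IntegrableOn q (Ioo 0 1)) {s : ℝ} (hs : s ∈ Icc (0 : ℝ) 1) :
    IntegrableOn (fun x => min (uniform.real {u | x < q u}) s) (Ioi 0) ∧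
      IntegrableOn (fun x => min (uniform.real {u | x < q u}) s - s) (Iic 0) ∧
      (∫ x in Ioi 0, min (uniform.real {u | x < q u}) s) +
        ∫ x in Iic 0, (min (uniform.real {u | x < q u}) s - s) = ∫ u in top s, q u := by
  have hi' : IntegrableOn q (top s) := hi.mono_set (top_subset hs)
  have h₁ := (integrableOn_and_integral_measureReal_lt (κ := volume.restrict (top s)) hi').1
  have h₂ := (integrableOn_and_integral_measureReal_lt_sub (κ := volume.restrict (top s)) hi').1
  have h₃ := integral_measureReal_lt_add (κ := volume.restrict (top s)) hi'
  simp only [measureReal_top_lt hq hs, measureReal_top_univ hs] at h₁ h₂ h₃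
  exact ⟨h₁, h₂, h₃⟩

/-! ### Riskmetrics of polylines -/

section Polyline

variable {f : ℝ → ℝ} {E : Finset ℝ} (P : HullPartition f E) {q : ℝ → ℝ}

theorem HullPartition.polyline_sub_one (t : ℝ) : P.polyline t - P.polyline 1 =
    ∑ i ∈ Finset.range P.m, P.c i *
      ((min t (P.s (i + 1)) - P.s (i + 1)) - (min t (P.s i) - P.s i)) := by
  rw [polyline, polyline, ← Finset.sum_sub_distrib]
  refine Finset.sum_congr rfl fun i hi => ?_
  have hi' := Finset.mem_range.1 hi
  rw [min_eq_right (P.s_mem (i + 1) hi').2, min_eq_right (P.s_mem i hi'.le).2]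
  ring

theorem integrableOn_polyline (hq : MonotoneOn q (Ioo 0 1)) (hi : IntegrableOn q (Ioo 0 1)) :
    IntegrableOn (fun x => P.polyline (uniform.real {u | x < q u})) (Ioi 0) := by
  refine integrable_finsetSum _ fun i hi' => ?_
  have hi' := Finset.mem_range.1 hi'
  exact ((integrableOn_min_survival hq hi (P.s_mem (i + 1) hi')).1.sub
    (integrableOn_min_survival hq hi (P.s_mem i hi'.le)).1).const_mul _

theorem integrableOn_polyline_sub (hq : MonotoneOn q (Ioo 0 1)) (hi : IntegrableOn q (Ioo 0 1)) :
    IntegrableOn (fun x => P.polyline (uniform.real {u | x < q u}) - P.polyline 1) (Iic 0) := by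
  simp only [P.polyline_sub_one]
  refine integrable_finsetSum _ fun i hi' => ?_
  have hi' := Finset.mem_range.1 hi'
  exact ((integrableOn_min_survival hq hi (P.s_mem (i + 1) hi')).2.1.sub
    (integrableOn_min_survival hq hi (P.s_mem i hi'.le)).2.1).const_mul _

/-- The riskmetric of a piecewise linear distortion depends only on the integrals of the quantile
function over the upper parts of the unit interval given by the partition. -/
theorem extIntegral_polyline (hq : MonotoneOn q (Ioo 0 1)) (hi : IntegrableOn q (Ioo 0 1)) :
    extIntegral (Ioi 0) (fun x => P.polyline (uniform.real {u | x < q u})) +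
      extIntegral (Iic 0) (fun x => P.polyline (uniform.real {u | x < q u}) - P.polyline 1) =
    ((∑ i ∈ Finset.range P.m,
      P.c i * ((∫ u in top (P.s (i + 1)), q u) - ∫ u in top (P.s i), q u) : ℝ) : EReal) := by
  rw [extIntegral_eq_integral (integrableOn_polyline P hq hi),
    extIntegral_eq_integral (integrableOn_polyline_sub P hq hi), ← EReal.coe_add]
  congr 1
  simp only [P.polyline_sub_one]
  simp only [HullPartition.polyline]
  have hI := fun i (hi' : i ≤ P.m) => integrableOn_min_survival hq hi (P.s_mem i hi')
  rw [integral_finsetSum, integral_finsetSum, ← Finset.sum_add_distrib]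
  · refine Finset.sum_congr rfl fun i hi' => ?_
    have hi' := Finset.mem_range.1 hi'
    rw [integral_const_mul, integral_const_mul, integral_sub (hI _ hi').1 (hI _ hi'.le).1,
      integral_sub (hI _ hi').2.1 (hI _ hi'.le).2.1, ← (hI _ hi').2.2, ← (hI _ hi'.le).2.2]
    ring
  · intro i hi'
    have hi' := Finset.mem_range.1 hi'
    exact ((hI _ hi').2.1.sub (hI _ hi'.le).2.1).const_mul _
  · intro i hi'
    have hi' := Finset.mem_range.1 hi'
    exact ((hI _ hi').1.sub (hI _ hi'.le).1).const_mul _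

end Polyline

/-! ### Quantile functions -/

section Quantile

/-- Right continuity of the cdf makes the infimum attained; `0 < u < 1` makes the set bounded below
and nonempty. -/
theorem leftQuantile_le_iff (μ : Measure ℝ) {u : ℝ} (hu : u ∈ Ioo (0 : ℝ) 1) (x : ℝ) :
    leftQuantile μ u ≤ x ↔ u ≤ cdf μ x := by
  have hbdd : BddBelow {x : ℝ | u ≤ cdf μ x} := by
    obtain ⟨y, hy⟩ := ((tendsto_cdf_atBot μ).eventually_lt_const hu.1).exists
    exact ⟨y, fun z hz => ((monotone_cdf μ).reflect_lt (hy.trans_le hz)).le⟩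
  have hne : {x : ℝ | u ≤ cdf μ x}.Nonempty :=
    ((tendsto_cdf_atTop μ).eventually_const_le hu.2).exists
  refine ⟨fun h => le_trans ?_ (monotone_cdf μ h), fun h => csInf_le hbdd h⟩
  have hr : Tendsto (cdf μ) (𝓝[>] leftQuantile μ u) (𝓝 (cdf μ (leftQuantile μ u))) :=
    ((cdf μ).right_continuous _).tendsto.mono_left (nhdsWithin_mono _ Ioi_subset_Ici_self)
  refine ge_of_tendsto hr ?_
  filter_upwards [self_mem_nhdsWithin] with y hy
  obtain ⟨z, hz, hzy⟩ := exists_lt_of_csInf_lt hne hy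
  exact le_trans hz (monotone_cdf μ hzy.le)

theorem monotoneOn_leftQuantile (μ : Measure ℝ) : MonotoneOn (leftQuantile μ) (Ioo 0 1) :=
  fun _ hu _ hv huv => (leftQuantile_le_iff μ hu _).2
    (huv.trans ((leftQuantile_le_iff μ hv _).1 le_rfl))

theorem uniform_Iic {c : ℝ} (hc : c ∈ Icc (0 : ℝ) 1) : uniform (Iic c) = ENNReal.ofReal c := by
  have h : (Iic c ∩ Ioo (0 : ℝ) 1 : Set ℝ) =ᵐ[volume] (Iio c ∩ Ioo (0 : ℝ) 1 : Set ℝ) :=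
    Iio_ae_eq_Iic.symm.inter (ae_eq_refl _)
  have h' : Iio c ∩ Ioo (0 : ℝ) 1 = Ioo 0 c := by
    ext v
    simp only [mem_inter_iff, mem_Iio, mem_Ioo]
    exact ⟨fun h => ⟨h.2.1, h.1⟩, fun h => ⟨h.2, h.1, h.2.trans_le hc.2⟩⟩
  rw [Measure.restrict_apply measurableSet_Iic, measure_congr h, h', Real.volume_Ioo, sub_zero]

theorem aemeasurable_leftQuantile (μ : Measure ℝ) : AEMeasurable (leftQuantile μ) uniform :=
  aemeasurable_restrict_of_monotoneOn measurableSet_Ioo (monotoneOn_leftQuantile μ)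

/-- The quantile transform. -/
theorem map_leftQuantile (μ : Measure ℝ) [IsProbabilityMeasure μ] :
    uniform.map (leftQuantile μ) = μ := by
  refine Measure.ext_of_Iic _ _ fun x => ?_
  rw [Measure.map_apply_of_aemeasurable (aemeasurable_leftQuantile μ) measurableSet_Iic,
    ← ofReal_cdf, ← uniform_Iic ⟨cdf_nonneg μ x, cdf_le_one μ x⟩]
  refine measure_congr ?_
  filter_upwards [ae_restrict_mem measurableSet_Ioo] with u hu
  exact propext (leftQuantile_le_iff μ hu x)

/-- A monotone function is almost everywhere the quantile function of its distribution. -/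
theorem leftQuantile_map_ae_eq {q : ℝ → ℝ} (hq : MonotoneOn q (Ioo 0 1)) :
    leftQuantile (uniform.map q) =ᵐ[uniform] q := by
  have hm : AEMeasurable q uniform := aemeasurable_restrict_of_monotoneOn measurableSet_Ioo hq
  have : IsProbabilityMeasure (uniform.map q) := Measure.isProbabilityMeasure_map hm
  have hcdf : ∀ x, cdf (uniform.map q) x = uniform.real {u | q u ≤ x} := fun x => by
    rw [cdf_eq_real, map_measureReal_apply_of_aemeasurable hm measurableSet_Iic]
    rfl
  have hreal : ∀ c ∈ Icc (0 : ℝ) 1, uniform.real (Iic c) = c := fun c hc => by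
    rw [measureReal_def, uniform_Iic hc, ENNReal.toReal_ofReal hc.1]
  have hle : ∀ u ∈ Ioo (0 : ℝ) 1, leftQuantile (uniform.map q) u ≤ q u := fun u hu => by
    rw [leftQuantile_le_iff _ hu, hcdf]
    nth_rewrite 1 [← hreal u (Ioo_subset_Icc_self hu)]
    rw [measureReal_restrict_apply' measurableSet_Ioo,
      measureReal_restrict_apply' measurableSet_Ioo]
    exact measureReal_mono (fun v hv => ⟨hq hv.2 hu hv.1, hv.2⟩)
      (measure_ne_top_of_subset inter_subset_right (by simp))
  have hge : ∀ u ∈ Ioo (0 : ℝ) 1, ∀ w ∈ Ioo (0 : ℝ) 1, w < u →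
      q w ≤ leftQuantile (uniform.map q) u := fun u hu w hw hwu => by
    by_contra! hlt
    have h₁ := (leftQuantile_le_iff (uniform.map q) hu _).1 le_rfl
    refine absurd (h₁.trans ?_) (not_le.2 hwu)
    rw [hcdf, ← hreal w (Ioo_subset_Icc_self hw), measureReal_restrict_apply' measurableSet_Ioo,
      measureReal_restrict_apply' measurableSet_Ioo]
    refine measureReal_mono (fun v hv => ⟨?_, hv.2⟩)
      (measure_ne_top_of_subset inter_subset_right (by simp))
    by_contra hvw
    exact absurd (hq hw hv.2 (not_le.1 hvw).le) (not_le.2 ((mem_ofPred_eq ▸ hv.1).trans_lt hlt))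
  -- The bounds `hle` and `hge` pinch at continuity points of `q`, and a monotone function has only
  -- countably many others.
  have hc := hq.countable_not_continuousWithinAt
  have hc' : ∀ᵐ u ∂uniform, u ∉ {x ∈ Ioo (0 : ℝ) 1 | ¬ContinuousWithinAt q (Ioo 0 1) x} :=
    measure_eq_zero_iff_ae_notMem.1 (hc.measure_zero _)
  filter_upwards [ae_restrict_mem measurableSet_Ioo, hc'] with u hu hu'
  have hcont : ContinuousAt q u := by
    by_contra h
    exact hu' ⟨hu, fun h' => h (h'.continuousAt (isOpen_Ioo.mem_nhds hu))⟩
  refine le_antisymm (hle u hu) (le_of_tendsto (hcont.tendsto.mono_left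
    (nhdsWithin_le_nhds (s := Iio u))) ?_)
  filter_upwards [Ioo_mem_nhdsLT hu.1] with w hw
  exact hge u hu w ⟨hw.1, hw.2.trans hu.2⟩ hw.2

end Quantile

/-! ### Concentration as averaging of the quantile function -/

section Flatten

open Classical in
/-- The function `q`, replaced on `C` by its mean over `C`. -/
def flatten (q : ℝ → ℝ) (C : Set ℝ) (u : ℝ) : ℝ := if u ∈ C then ⨍ v in C, q v else q u

theorem flatten_of_mem (q : ℝ → ℝ) {C : Set ℝ} {u : ℝ} (hu : u ∈ C) :
    flatten q C u = ⨍ v in C, q v := if_pos hu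

theorem flatten_of_notMem (q : ℝ → ℝ) {C : Set ℝ} {u : ℝ} (hu : u ∉ C) :
    flatten q C u = q u := if_neg hu

variable {q : ℝ → ℝ} {a b : ℝ}

theorem concentration_map (hq : MonotoneOn q (Ioo 0 1)) (ha : 0 ≤ a) (hb : b ≤ 1) :
    concentration (uniform.map q) (Ioo a b) = uniform.map (flatten q (Ioo a b)) := by
  have hae := leftQuantile_map_ae_eq hq
  have havg : ⨍ v in Ioo a b, leftQuantile (uniform.map q) v = ⨍ v in Ioo a b, q v :=
    average_congr (ae_restrict_of_ae_restrict_of_subset (Ioo_subset_Ioo ha hb) hae)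
  rw [concentration, restrict_Icc_eq_uniform]
  refine Measure.map_congr ?_
  filter_upwards [hae] with u hu
  simp only [flatten, havg, hu]
  split_ifs <;> rfl

/-- The mean over the interval lies between the values of `q` to its left and to its right.
Monotonicity lets concentrations be iterated. -/
theorem monotoneOn_flatten (hq : MonotoneOn q (Ioo 0 1)) (hi : IntegrableOn q (Ioo 0 1))
    (ha : 0 ≤ a) (hab : a < b) (hb : b ≤ 1) : MonotoneOn (flatten q (Ioo a b)) (Ioo 0 1) := by
  have hsub : Ioo a b ⊆ Ioo 0 1 := Ioo_subset_Ioo ha hb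
  have hne : (volume (Ioo a b) : ENNReal) ≠ 0 := by
    simp [hab]
  have hfin : (volume (Ioo a b) : ENNReal) ≠ ⊤ := by simp
  have hlow : ∀ u ∈ Ioo (0 : ℝ) 1, u ≤ a → q u ≤ ⨍ v in Ioo a b, q v := fun u hu hua =>
    (convex_Ici (q u)).set_average_mem isClosed_Ici hne hfin
      ((ae_restrict_mem measurableSet_Ioo).mono fun v hv =>
        hq hu (hsub hv) (hua.trans hv.1.le)) (hi.mono_set hsub)
  have hupp : ∀ u ∈ Ioo (0 : ℝ) 1, b ≤ u → ⨍ v in Ioo a b, q v ≤ q u := fun u hu hub =>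
    (convex_Iic (q u)).set_average_mem isClosed_Iic hne hfin
      ((ae_restrict_mem measurableSet_Ioo).mono fun v hv =>
        hq (hsub hv) hu (hv.2.le.trans hub)) (hi.mono_set hsub)
  intro u hu v hv huv
  by_cases hu' : u ∈ Ioo a b <;> by_cases hv' : v ∈ Ioo a b
  · rw [flatten_of_mem q hu', flatten_of_mem q hv']
  · rw [flatten_of_mem q hu', flatten_of_notMem q hv']
    exact hupp v hv (not_lt.1 fun h => hv' ⟨hu'.1.trans_le huv, h⟩)
  · rw [flatten_of_notMem q hu', flatten_of_mem q hv']
    exact hlow u hu (not_lt.1 fun h => hu' ⟨h, huv.trans_lt hv'.2⟩)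
  · rw [flatten_of_notMem q hu', flatten_of_notMem q hv']
    exact hq hu hv huv

theorem integrableOn_flatten (hi : IntegrableOn q (Ioo 0 1)) :
    IntegrableOn (flatten q (Ioo a b)) (Ioo 0 1) := by
  classical
  have : flatten q (Ioo a b) = (Ioo a b).piecewise (fun _ => ⨍ v in Ioo a b, q v) q := by
    ext u
    simp only [flatten, piecewise]
    split_ifs <;> rfl
  rw [this]
  exact Integrable.piecewise measurableSet_Ioo (integrable_const _).integrableOn hi.integrableOn

theorem setIntegral_flatten_of_disjoint {D : Set ℝ} (hD : MeasurableSet D)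
    (h : Disjoint D (Ioo a b)) : ∫ u in D, flatten q (Ioo a b) u = ∫ u in D, q u :=
  setIntegral_congr_fun hD fun _ hu => flatten_of_notMem q (disjoint_left.1 h hu)

theorem setIntegral_flatten_of_subset {D : Set ℝ} (hi : IntegrableOn q (Ioo 0 1))
    (hD : MeasurableSet D) (hDI : D ⊆ Ioo 0 1) (h : Ioo a b ⊆ D) (hab : a < b) :
    ∫ u in D, flatten q (Ioo a b) u = ∫ u in D, q u := by
  have hC : ∫ u in Ioo a b, flatten q (Ioo a b) u = ∫ u in Ioo a b, q u := by
    rw [setIntegral_congr_fun measurableSet_Ioo fun u hu => flatten_of_mem q hu,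
      setIntegral_const, setAverage_eq, smul_smul, mul_inv_cancel₀, one_smul]
    rw [Real.volume_real_Ioo_of_le hab.le]
    exact (sub_pos.2 hab).ne'
  have e₁ := integral_inter_add_sdiff (measurableSet_Ioo (a := a) (b := b))
    ((integrableOn_flatten (a := a) (b := b) hi).mono_set hDI)
  have e₂ := integral_inter_add_sdiff (measurableSet_Ioo (a := a) (b := b)) (hi.mono_set hDI)
  rw [← e₁, ← e₂, inter_eq_right.2 h, hC, setIntegral_flatten_of_disjoint
    (hD.diff measurableSet_Ioo) disjoint_sdiff_left]

end Flatten

/-! ### Concentration on all cells of a partition -/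

section Concentrate

variable {f : ℝ → ℝ} {E : Finset ℝ} (P : HullPartition f E) {q : ℝ → ℝ}

/-- The cells of the partition, in terms of the levels of the quantile function. -/
abbrev HullPartition.cell (j : ℕ) : Set ℝ := Ioo (1 - P.s (j + 1)) (1 - P.s j)

theorem exists_constant_on_cells {N : Set (Measure ℝ)} (hN : ClosedUnderConcentration N)
    (hq : MonotoneOn q (Ioo 0 1)) (hi : IntegrableOn q (Ioo 0 1)) (hqN : uniform.map q ∈ N) :
    ∃ r : ℝ → ℝ, MonotoneOn r (Ioo 0 1) ∧ IntegrableOn r (Ioo 0 1) ∧ uniform.map r ∈ N ∧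
      (∀ j ≤ P.m, ∫ u in top (P.s j), r u = ∫ u in top (P.s j), q u) ∧
      ∀ j < P.m, ∀ u ∈ P.cell j, ∀ v ∈ P.cell j, r u = r v := by
  have key : ∀ i ≤ P.m, ∃ r : ℝ → ℝ, MonotoneOn r (Ioo 0 1) ∧ IntegrableOn r (Ioo 0 1) ∧
      uniform.map r ∈ N ∧ (∀ j ≤ P.m, ∫ u in top (P.s j), r u = ∫ u in top (P.s j), q u) ∧
      ∀ j < i, ∀ u ∈ P.cell j, ∀ v ∈ P.cell j, r u = r v := by
    intro i
    induction i with
    | zero => exact fun _ => ⟨q, hq, hi, hqN, fun _ _ => rfl, fun j hj => absurd hj (by simp)⟩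
    | succ i ih =>
      intro him
      obtain ⟨r, hr, hri, hrN, hrint, hrc⟩ := ih (by omega)
      have hlt : 1 - P.s (i + 1) < 1 - P.s i := sub_lt_sub_left (P.lt_succ i him) 1
      have ha : 0 ≤ 1 - P.s (i + 1) := sub_nonneg.2 (P.s_mem _ him).2
      have hb : 1 - P.s i ≤ 1 := sub_le_self 1 (P.s_mem i (by omega)).1
      refine ⟨flatten r (P.cell i), monotoneOn_flatten hr hri ha hlt hb,
        integrableOn_flatten hri, ?_, fun j hj => ?_, fun j hj u hu v hv => ?_⟩
      · rw [← concentration_map hr ha hb]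
        exact hN _ hrN _ ordConnected_Ioo
          ((Ioo_subset_Ioo ha hb).trans Ioo_subset_Icc_self)
      · rw [← hrint j hj]
        -- Each upper interval `top (P.s j)` is either disjoint from cell `i` or contains it, so
        -- averaging over the cell leaves its integral unchanged.
        rcases le_or_gt j i with hji | hij
        · refine setIntegral_flatten_of_disjoint measurableSet_Ioo ?_
          refine disjoint_left.2 fun u hu hu' => ?_
          have := P.mono hji
          linarith [hu.1, hu'.2]
        · exact setIntegral_flatten_of_subset hri measurableSet_Ioo (top_subset (P.s_mem j hj))
            (Ioo_subset_Ioo (sub_le_sub_left (P.mono hij) 1) hb) hlt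
      · rcases (Nat.lt_succ_iff.1 hj).eq_or_lt with rfl | hji
        · rw [flatten_of_mem r hu, flatten_of_mem r hv]
        · have hout : ∀ w ∈ P.cell j, w ∉ P.cell i := fun w hw hw' => by
            have := P.mono (Nat.succ_le_of_lt hji)
            rw [Nat.succ_eq_add_one] at this
            linarith [hw.1, hw'.2]
          rw [flatten_of_notMem r (hout u hu), flatten_of_notMem r (hout v hv)]
          exact hrc j hji u hu v hv
  exact key P.m le_rfl

/-- A function that is constant on the cells has survival probabilities in the partition. -/
theorem exists_survival_eq (hq : MonotoneOn q (Ioo 0 1))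
    (hc : ∀ j < P.m, ∀ u ∈ P.cell j, ∀ v ∈ P.cell j, q u = q v) (x : ℝ) :
    ∃ j ≤ P.m, uniform.real {u | x < q u} = P.s j := by
  obtain ⟨j, hj, hjt⟩ := P.exists_cell (t := uniform.real {u | x < q u})
    ⟨measureReal_nonneg, measureReal_le_one⟩
  have hsj := P.s_mem j hj.le
  have hsj' := P.s_mem (j + 1) hj
  obtain ⟨w, hw⟩ : (P.cell j).Nonempty := nonempty_Ioo.2 (sub_lt_sub_left (P.lt_succ j hj) 1)
  have hwI : w ∈ Ioo (0 : ℝ) 1 := ⟨by linarith [hw.1, hsj'.2], by linarith [hw.2, hsj.1]⟩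
  -- The whole cell lies on one side of level `x`, which forces the survival probability to one end
  -- of `[s j, s (j + 1)]`.
  rcases lt_or_ge x (q w) with hx | hx
  · refine ⟨j + 1, hj, le_antisymm hjt.2 ?_⟩
    have hsub : top (P.s (j + 1)) ⊆ {u | x < q u} ∩ Ioo 0 1 := fun u hu => by
      have huI := top_subset hsj' hu
      refine ⟨?_, huI⟩
      rcases le_total w u with h | h
      · exact hx.trans_le (hq hwI huI h)
      · exact hx.trans_eq (hc j hj u ⟨hu.1, h.trans_lt hw.2⟩ w hw).symm
    rw [measureReal_restrict_apply' measurableSet_Ioo]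
    calc P.s (j + 1) = volume.real (top (P.s (j + 1))) := by
          rw [← measureReal_restrict_apply_univ, measureReal_top_univ hsj']
      _ ≤ _ := measureReal_mono hsub (measure_ne_top_of_subset inter_subset_right (by simp))
  · refine ⟨j, hj.le, le_antisymm ?_ hjt.1⟩
    have hsub : {u | x < q u} ∩ Ioo 0 1 ⊆ Ico (1 - P.s j) 1 := fun u hu => by
      refine ⟨?_, hu.2.2⟩
      by_contra! h
      refine absurd hu.1 (not_lt.2 (le_trans ?_ hx))
      rcases le_total u w with huw | hwu
      · exact hq hu.2 hwI huw
      · exact (hc j hj u ⟨hw.1.trans_le hwu, h⟩ w hw).le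
    rw [measureReal_restrict_apply' measurableSet_Ioo]
    calc _ ≤ volume.real (Ico (1 - P.s j) 1) := measureReal_mono hsub (by simp)
      _ = P.s j := by rw [Real.volume_real_Ico_of_le (by linarith [hsj.1])]; ring

end Concentrate

/-! ### Comparison of the worst cases -/

section Riskmetric

variable {h : ℝ → ℝ}

theorem riskmetric_map (h : ℝ → ℝ) {Ω : Type*} [MeasurableSpace Ω] (P : Measure Ω) {Y : Ω → ℝ}
    (hY : AEMeasurable Y P) : riskmetric h (P.map Y) id = riskmetric h P Y := by
  have : ∀ x : ℝ, (P.map Y).real {ω | x < id ω} = P.real {ω | x < Y ω} := fun x =>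
    map_measureReal_apply_of_aemeasurable hY measurableSet_Ioi
  simp only [riskmetric, this]

theorem riskmetric_mono {Ω : Type*} [MeasurableSpace Ω] (P : Measure Ω) [IsProbabilityMeasure P]
    (Y : Ω → ℝ) {f g : ℝ → ℝ} (hfg : ∀ t ∈ Icc (0 : ℝ) 1, f t ≤ g t) (h1 : f 1 = g 1) :
    riskmetric f P Y ≤ riskmetric g P Y := by
  have hmem : ∀ x : ℝ, P.real {ω | x < Y ω} ∈ Icc (0 : ℝ) 1 := fun x =>
    ⟨measureReal_nonneg, measureReal_le_one⟩
  refine add_le_add (extIntegral_mono measurableSet_Ioi fun x _ => hfg _ (hmem x))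
    (extIntegral_mono measurableSet_Iic fun x _ => ?_)
  rw [h1]
  exact sub_le_sub_right (hfg _ (hmem x)) _

/-- After concentration on the cells of a partition, the riskmetric of `h` coincides with the
riskmetric of its interpolation before concentration. -/
theorem exists_riskmetric_eq_polyline (h0 : h 0 = 0) {E : Finset ℝ} (P : HullPartition h E)
    {N : Set (Measure ℝ)} (hN : ClosedUnderConcentration N) {q : ℝ → ℝ}
    (hq : MonotoneOn q (Ioo 0 1)) (hi : IntegrableOn q (Ioo 0 1)) (hqN : uniform.map q ∈ N) :
    ∃ ν ∈ N, riskmetric h ν id = riskmetric P.polyline uniform q := by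
  obtain ⟨r, hr, hri, hrN, hrint, hrc⟩ := exists_constant_on_cells P hN hq hi hqN
  refine ⟨uniform.map r, hrN, ?_⟩
  rw [riskmetric_map h uniform (aemeasurable_restrict_of_monotoneOn measurableSet_Ioo hr)]
  have hS : ∀ x, h (uniform.real {u | x < r u}) = P.polyline (uniform.real {u | x < r u}) :=
    fun x => by
      obtain ⟨j, hj, hjx⟩ := exists_survival_eq P hr hrc x
      rw [hjx, P.polyline_s h0 hj]
  simp only [riskmetric, hS, ← P.polyline_one h0]
  rw [extIntegral_polyline P hr hri, extIntegral_polyline P hq hi]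
  congr 1
  refine Finset.sum_congr rfl fun i hi' => ?_
  have hi' := Finset.mem_range.1 hi'
  rw [hrint _ hi', hrint _ hi'.le]

/-- It is enough to bound `ρ_g` for the limit `g` of the polylines: only `h* ≤ g` and `h* 1 = g 1`
are needed, not `g = h*`. -/
theorem riskmetric_concaveEnvelope_le (hh : IsDistortion h) {N : Set (Measure ℝ)}
    (hN : ClosedUnderConcentration N) {q : ℝ → ℝ} (hq : MonotoneOn q (Ioo 0 1))
    (hi : IntegrableOn q (Ioo 0 1)) (hqN : uniform.map q ∈ N) :
    riskmetric (concaveEnvelope h) uniform q ≤ ⨆ ν ∈ N, riskmetric h ν id := by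
  obtain ⟨E, P, g, hmono, hlim, hg, hgc, hhg, hg1⟩ := exists_hull_sequence hh
  refine (riskmetric_mono uniform q (fun t ht => concaveEnvelope_le hg hhg hgc ht)
    (by rw [concaveEnvelope_one hh, hg1])).trans ?_
  have hmem : ∀ x : ℝ, uniform.real {u | x < q u} ∈ Icc (0 : ℝ) 1 := fun x =>
    ⟨measureReal_nonneg, measureReal_le_one⟩
  have hS := measurable_measureReal_lt uniform q
  have hm : ∀ k, Measurable fun x => (P k).polyline (uniform.real {u | x < q u}) := fun k =>
    (P k).continuous_polyline.measurable.comp hS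
  have hone : ∀ k, (P k).polyline 1 = g 1 := fun k => by rw [(P k).polyline_one hh.2, hg1]
  -- The first polyline gives the integrable lower bound for monotone convergence.
  obtain ⟨t₁, b₁⟩ := tendsto_extIntegral measurableSet_Ioi hm
    (fun x _ => hmono _ (hmem x)) (fun x _ => hlim _ (hmem x)) (integrableOn_polyline (P 0) hq hi)
  obtain ⟨t₂, b₂⟩ := tendsto_extIntegral measurableSet_Iic
    (f := fun k x => (P k).polyline (uniform.real {u | x < q u}) - (P k).polyline 1)
    (F := fun x => g (uniform.real {u | x < q u}) - g 1)
    (fun k => (hm k).sub_const _)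
    (fun x _ i j hij => by
      simp only [hone]
      exact sub_le_sub_right (hmono _ (hmem x) hij) _)
    (fun x _ => by
      simp only [hone]
      exact (hlim _ (hmem x)).sub_const _)
    (integrableOn_polyline_sub (P 0) hq hi)
  have hlim' : Tendsto (fun k => riskmetric (P k).polyline uniform q) atTop
      (𝓝 (riskmetric g uniform q)) :=
    (EReal.continuousAt_add (p := (_, _)) (Or.inr b₂) (Or.inl b₁)).tendsto.comp
      (t₁.prodMk_nhds t₂)
  refine le_of_tendsto' hlim' fun k => ?_
  obtain ⟨ν, hνN, hν⟩ := exists_riskmetric_eq_polyline hh.2 (P k) hN hq hi hqN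
  rw [← hν]
  exact le_iSup₂_of_le ν hνN le_rfl

/-- On a set of distributions closed under concentration, a distortion function and its concave
envelope have the same worst-case riskmetric. -/
theorem iSup_riskmetric_concaveEnvelope (hh : IsDistortion h) {N : Set (Measure ℝ)}
    (hN : ClosedUnderConcentration N) (hp : ∀ ν ∈ N, IsProbabilityMeasure ν)
    (hint : ∀ ν ∈ N, Integrable id ν) :
    ⨆ ν ∈ N, riskmetric h ν id = ⨆ ν ∈ N, riskmetric (concaveEnvelope h) ν id := by
  refine le_antisymm (iSup₂_mono fun ν hν => ?_) (iSup₂_le fun ν hν => ?_)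
  · have := hp ν hν
    exact riskmetric_mono ν id (fun t ht => le_concaveEnvelope hh ht) (concaveEnvelope_one hh).symm
  · have := hp ν hν
    have hm := aemeasurable_leftQuantile ν
    have hmap := map_leftQuantile ν
    have hi : IntegrableOn (leftQuantile ν) (Ioo 0 1) := by
      have h₁ := hint ν hν
      rw [← hmap] at h₁
      exact (integrable_map_measure measurable_id.aestronglyMeasurable hm).1 h₁
    have hle := riskmetric_concaveEnvelope_le hh hN (monotoneOn_leftQuantile ν) hi (hmap.symm ▸ hν)
    rwa [← riskmetric_map _ uniform hm, hmap] at hle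

theorem iSup_riskmetric_portfolio {n : ℕ} (h : ℝ → ℝ) (M : Set (Measure (Fin n → ℝ)))
    (a : Fin n → ℝ) :
    ⨆ μ ∈ M, riskmetric h μ (fun x : Fin n → ℝ => a ⬝ᵥ x) =
      ⨆ ν ∈ portfolioLaws M a, riskmetric h ν id := by
  rw [portfolioLaws, iSup_image]
  refine iSup_congr fun μ => iSup_congr fun _ => (riskmetric_map h μ ?_).symm
  have : Continuous fun x : Fin n → ℝ => a ⬝ᵥ x := by
    unfold dotProduct
    fun_prop
  exact this.measurable.aemeasurable

theorem robustObjective_concaveEnvelope {n : ℕ} (hh : IsDistortion h)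
    {M : Set (Measure (Fin n → ℝ))} (hM : M ⊆ FiniteMeanLaws n) (β : (Fin n → ℝ) → ℝ)
    {a : Fin n → ℝ} (ha : ClosedUnderConcentration (portfolioLaws M a)) :
    robustObjective h M β a = robustObjective (concaveEnvelope h) M β a := by
  have hcont : Continuous fun x : Fin n → ℝ => a ⬝ᵥ x := by
    unfold dotProduct
    fun_prop
  rw [robustObjective, robustObjective, iSup_riskmetric_portfolio, iSup_riskmetric_portfolio,
    iSup_riskmetric_concaveEnvelope hh ha]
  · rintro _ ⟨μ, hμ, rfl⟩
    have := (hM hμ).1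
    exact Measure.isProbabilityMeasure_map hcont.measurable.aemeasurable
  · rintro _ ⟨μ, hμ, rfl⟩
    refine (integrable_map_measure measurable_id.aestronglyMeasurable
      hcont.measurable.aemeasurable).2 ?_
    have hx : Integrable (fun x : Fin n → ℝ => x) μ :=
      (integrable_norm_iff measurable_id.aestronglyMeasurable).1 (hM hμ).2
    have : id ∘ (fun x : Fin n → ℝ => a ⬝ᵥ x) = fun x => ∑ i, a i * x i := rfl
    rw [this]
    exact integrable_finsetSum _ fun i _ => (hx.eval i).const_mul _

end Riskmetric

end RobustPortfolio

end

theorem proposition6 (n : ℕ) (h : ℝ → ℝ) (hh : RobustPortfolio.IsDistortion h)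
    (A : Set (Fin n → ℝ)) (β : (Fin n → ℝ) → ℝ)
    (M : Set (Measure (Fin n → ℝ))) (hM : M ⊆ RobustPortfolio.FiniteMeanLaws n)
    (hC : ∀ a ∈ A, RobustPortfolio.ClosedUnderConcentration (RobustPortfolio.portfolioLaws M a)) :
    (⨅ a ∈ A, RobustPortfolio.robustObjective h M β a) =
        (⨅ a ∈ A, RobustPortfolio.robustObjective (RobustPortfolio.concaveEnvelope h) M β a) ∧
      ∀ a ∈ A, (IsMinOn (RobustPortfolio.robustObjective h M β) A a ↔
        IsMinOn (RobustPortfolio.robustObjective (RobustPortfolio.concaveEnvelope h) M β) A a) := by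
  have key : ∀ a ∈ A, RobustPortfolio.robustObjective h M β a =
      RobustPortfolio.robustObjective (RobustPortfolio.concaveEnvelope h) M β a := fun a ha =>
    RobustPortfolio.robustObjective_concaveEnvelope hh hM β (hC a ha)
  refine ⟨iInf_congr fun a => iInf_congr fun ha => key a ha, fun a ha => ?_⟩
  simp only [isMinOn_iff]
  refine forall₂_congr fun x hx => ?_
  rw [key a ha, key x hx]
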